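/- Let $(M,g)$ and $(\bar M,\bar g)$ be smooth Riemannian manifolds with curvature tensors $R,\bar R$ (where $R_{X,Y}=[\nabla_X,\nabla_Y]-\nabla_{[X,Y]}$ and $K(v\wedge w)=g(R_{v,w}w,v)$ for orthonormal $v,w$), let $\mathcal D$ be a smooth distribution on $M$ of rank $d\ge 2$ and $\bar{\mathcal D}$ a smooth distribution on $\bar M$. Let $f:M\to\bar M$ be an isometric immersion with $f_*(\mathcal D)\subset\bar{\mathcal D}$ (an adapted isometric immersion), with second fundamental form $\bar h$. Suppose that $\mathcal D=\mathcal D_1\oplus\mathcal D_2$ is the sum of two orthogonal smooth distributions of ranks $1$ and $d-1$, and that $\mathcal D_1$ is spanned by a smooth unit vector field $N$. For a subspace $V\subset T_xM$ with an orthonormal basis $(e_i)$ put $\bar H_V=\sum_i\bar h(e_i,e_i)$, and let $\bar H_{\mathcal D},\bar H_1,\bar H_2$ be the vectors so obtained for $\mathcal D_x,\mathcal D_1(x),\mathcal D_2(x)$. Let $\mathrm{Ric}_{N,N}$ denote the Ricci curvature of $M$ in the direction $N$ along $\mathcal D$, that is, $\mathrm{Ric}_{N,N}(x)=\sum_{i=1}^{d}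 g(R_{e_i,N}N,e_i)$ for an orthonormal basis $(e_i)$ of $\mathcal D_x$ (the mutual curvature $\mathrm S_{\rm m}(\mathcal D_1,\mathcal D_2)$; it is the usual Ricci curvature if $\mathcal D=TM$), and let $\overline{\mathrm{Ric}}_{N,N}(x)=\sum_{i=1}^{d}\bar g(\bar R_{f_*e_i,f_*N}f_*N,f_*e_i)$ be the same quantity for $\bar R$ and $f_*\mathcal D_x$. For $y\in\bar M$ let $\bar r_{d-1|\bar{\mathcal D}}(y)$ be the supremum of the $(d-1)$-th Ricci curvature $\sum_{i=1}^{d-1}\bar K(e_0\wedge e_i)$ over all orthonormal $e_0,\dots,e_{d-1}\in\bar{\mathcal D}_y$. Then at every point $x\in M$ $$\mathrm{Ric}_{N,N}\le\tfrac14\,\|\bar H_{\mathcal D}\|^2+\bar r_{d-1|\bar{\mathcal D}}(f(x)).$$ Equality holds at $x$ if and only if the following three conditions hold: $f$ is mixed totally geodesic on $\mathcal D_x$, i.e. $\bar h(X,Y)=0$ for all $X\in\mathcal D_1(x)$, $Y\in\mathcal D_2(x)$; $\bar H_1(x)=\bar H_2(x)$; and $\overline{\mathrm{Ric}}_{N,N}(x)=\bar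 r_{d-1|\bar{\mathcal D}}(f(x))$. -/

import Mathlib

open Bundle Module
open scoped Manifold ContDiff RealInnerProductSpace

noncomputable section

namespace SubRiem

/-! ### Levi-Civita calculus of a metric on an open set of a normed space

`G u v w` is the value at the point `u` of the metric on the constant vector fields `v`, `w`. -/

section Local

variable {E : Type*} [NormedAddCommGroup E] [NormedSpace ℝ E]

/-- The Christoffel symbol of the first kind, as a linear form in its last slot:
`z ↦ ½ (∂_v G(w, z) + ∂_w G(v, z) - ∂_z G(v, w))`. -/
def christoffelFirst (G : E → E →L[ℝ] E →L[ℝ] ℝ) (u v w : E) : E →L[ℝ] ℝ :=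
  (2⁻¹ : ℝ) • (fderiv ℝ G u v w + fderiv ℝ G u w v - ((fderiv ℝ G u).flip v).flip w)

/-- The Christoffel symbol `Γ(v, w) = ∇_v w` (for constant fields `v`, `w`) of the Levi-Civita
connection of `G`: the vector with `G(Γ(v, w), z) = christoffelFirst G u v w z` for all `z`. -/
def christoffel (G : E → E →L[ℝ] E →L[ℝ] ℝ) (u v w : E) : E :=
  (G u).inverse (christoffelFirst G u v w)

/-- The curvature `R_{X,Y} Z = ∇_X ∇_Y Z - ∇_Y ∇_X Z` of `G` on constant vector fields
(for which `[X, Y] = 0`). -/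
def curvature (G : E → E →L[ℝ] E →L[ℝ] ℝ) (u X Y Z : E) : E :=
  fderiv ℝ (fun u' => christoffel G u' Y Z) u X - fderiv ℝ (fun u' => christoffel G u' X Z) u Y
    + christoffel G u X (christoffel G u Y Z) - christoffel G u Y (christoffel G u X Z)

end Local

/-! ### Curvature of a Riemannian manifold, and distributions -/

section Manifold

variable {E : Type*} [NormedAddCommGroup E] [NormedSpace ℝ E]
  {M : Type*} [TopologicalSpace M] [ChartedSpace E M]

instance instFiniteDimensionalTangentSpace [FiniteDimensional ℝ E] (x : M) :
    FiniteDimensional ℝ (TangentSpace 𝓘(ℝ, E) x) :=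
  inferInstanceAs (FiniteDimensional ℝ E)

variable (E M) in
/-- A smooth distribution of rank `r` on `M`: a subbundle of rank `r` of the tangent bundle,
that is, a field of `r`-dimensional subspaces locally spanned by `r` smooth vector fields. -/
structure Distribution [IsManifold 𝓘(ℝ, E) ∞ M] (r : ℕ) where
  fiber : ∀ x : M, Submodule ℝ (TangentSpace 𝓘(ℝ, E) x)
  finrank_fiber : ∀ x, finrank ℝ (fiber x) = r
  exists_local_frame : ∀ x₀ : M, ∃ U : Set M, IsOpen U ∧ x₀ ∈ U ∧
    ∃ X : Fin r → ∀ x : M, TangentSpace 𝓘(ℝ, E) x,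
      (∀ i, ContMDiffOn 𝓘(ℝ, E) 𝓘(ℝ, E).tangent ∞
        (fun x => (⟨x, X i x⟩ : TangentBundle 𝓘(ℝ, E) M)) U) ∧
      ∀ x ∈ U, Submodule.span ℝ (Set.range fun i => X i x) = fiber x

variable [RiemannianBundle (fun x : M => TangentSpace 𝓘(ℝ, E) x)]

/-- The metric of `M` read in the preferred chart `φ` at `x`: at a point `u` of the chart it is
`(v, w) ↦ ⟪dφ⁻¹ v, dφ⁻¹ w⟫`, the inner product being that of the tangent space at `φ⁻¹ u`. -/
def chartMetric (x : M) (u : E) : E →L[ℝ] E →L[ℝ] ℝ :=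
  (innerSL ℝ (E := TangentSpace 𝓘(ℝ, E) ((extChartAt 𝓘(ℝ, E) x).symm u))).bilinearComp
    (mfderiv 𝓘(ℝ, E) 𝓘(ℝ, E) (extChartAt 𝓘(ℝ, E) x).symm u)
    (mfderiv 𝓘(ℝ, E) 𝓘(ℝ, E) (extChartAt 𝓘(ℝ, E) x).symm u)

/-- The Riemannian curvature tensor `R_{X,Y} Z` at `x`, computed in the preferred chart at `x`.
Recall that `TangentSpace 𝓘(ℝ, E) x` is `E` by definition, a tangent vector at `x` being
identified with its coordinates in that chart. -/
def riemannCurvature (x : M) (X Y Z : TangentSpace 𝓘(ℝ, E) x) : TangentSpace 𝓘(ℝ, E) x :=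
  curvature (chartMetric (E := E) x) (extChartAt 𝓘(ℝ, E) x x) X Y Z

/-- The sectional curvature `K(v ∧ w) = ⟪R_{v,w} w, v⟫` of the plane spanned by two orthonormal
tangent vectors `v`, `w` (it is only used for orthonormal `v`, `w`). -/
def sectionalCurvature (x : M) (v w : TangentSpace 𝓘(ℝ, E) x) : ℝ :=
  ⟪riemannCurvature x v w w, v⟫

/-- The Ricci curvature along a subspace `V` of the tangent space at `x`: the contraction
`tr_V (Z ↦ R_{Z,X} Y) = ∑ᵢ ⟪R_{eᵢ,X} Y, eᵢ⟫` over an orthonormal basis `(eᵢ)` of `V`.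
For `V = ⊤` this is the Ricci tensor; if `X = Y = e₁` is one of the basis vectors, it is
`∑_{i ≠ 1} K(eᵢ ∧ e₁)`, the mutual curvature of the line `ℝ e₁` and its complement in `V`. -/
def ricciAlong [FiniteDimensional ℝ E] (x : M) (V : Submodule ℝ (TangentSpace 𝓘(ℝ, E) x))
    (X Y : TangentSpace 𝓘(ℝ, E) x) : ℝ :=
  ∑ i, ⟪riemannCurvature x (stdOrthonormalBasis ℝ V i : TangentSpace 𝓘(ℝ, E) x) X Y,
    (stdOrthonormalBasis ℝ V i : TangentSpace 𝓘(ℝ, E) x)⟫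

/-- The `q`-th Ricci curvature `∑_{i=1}^q K(e₀ ∧ eᵢ)` of `q + 1` orthonormal vectors
`e₀, e₁, …, e_q` at `x`. -/
def qRicci (x : M) {q : ℕ} (e : Fin (q + 1) → TangentSpace 𝓘(ℝ, E) x) : ℝ :=
  ∑ i : Fin q, sectionalCurvature x (e 0) (e i.succ)

/-- The supremum at `x` of the `q`-th Ricci curvature along a subspace `V` of the tangent space
at `x`, over all orthonormal `e₀, …, e_q` in `V`. (If `q + 1 ≤ dim V < ∞` this is a
maximum of a continuous function on a nonempty compact set.) -/
def supQRicci (q : ℕ) (x : M) (V : Submodule ℝ (TangentSpace 𝓘(ℝ, E) x)) : ℝ :=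
  sSup {r : ℝ | ∃ e : Fin (q + 1) → TangentSpace 𝓘(ℝ, E) x,
    Orthonormal ℝ e ∧ (∀ i, e i ∈ V) ∧ r = qRicci x e}

end Manifold

/-! ### Isometric immersions -/

section Immersion

variable {E : Type*} [NormedAddCommGroup E] [NormedSpace ℝ E]
  {M : Type*} [TopologicalSpace M] [ChartedSpace E M]
  [RiemannianBundle (fun x : M => TangentSpace 𝓘(ℝ, E) x)]
  {E' : Type*} [NormedAddCommGroup E'] [NormedSpace ℝ E']
  {M' : Type*} [TopologicalSpace M'] [ChartedSpace E' M']
  [RiemannianBundle (fun y : M' => TangentSpace 𝓘(ℝ, E') y)]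

/-- A smooth map whose differential preserves inner products; in particular the differential is
injective at every point, so that the map is an immersion. -/
structure IsIsometricImmersion (f : M → M') : Prop where
  contMDiff : ContMDiff 𝓘(ℝ, E) 𝓘(ℝ, E') ∞ f
  inner_mfderiv : ∀ (x : M) (v w : TangentSpace 𝓘(ℝ, E) x),
    ⟪mfderiv 𝓘(ℝ, E) 𝓘(ℝ, E') f x v, mfderiv 𝓘(ℝ, E) 𝓘(ℝ, E') f x w⟫ = ⟪v, w⟫

/-- The second fundamental form `h(X, Y) = ∇'_X (f_* Y) - f_* (∇_X Y)` of `f` at `x` (Gauss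
formula), computed in the preferred charts at `x` and `f x`, where `f` reads `F`:
`h(X, Y) = D²F(X, Y) + Γ'(DF X, DF Y) - DF (Γ(X, Y))`. -/
def secondFundamentalForm (f : M → M') (x : M) (X Y : TangentSpace 𝓘(ℝ, E) x) :
    TangentSpace 𝓘(ℝ, E') (f x) :=
  let F : E → E' := writtenInExtChartAt 𝓘(ℝ, E) 𝓘(ℝ, E') x f
  let u : E := extChartAt 𝓘(ℝ, E) x x
  let h : E' := fderiv ℝ (fderiv ℝ F) u X Y
    + christoffel (chartMetric (E := E') (f x)) (F u) (fderiv ℝ F u X) (fderiv ℝ F u Y)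
    - fderiv ℝ F u (christoffel (chartMetric (E := E) x) u X Y)
  h

/-- The mean curvature vector `∑ᵢ h(eᵢ, eᵢ)` of a subspace `V` of the tangent space at `x`, where
`(eᵢ)` is an orthonormal basis of `V`. -/
def meanCurvature [FiniteDimensional ℝ E] (f : M → M') (x : M)
    (V : Submodule ℝ (TangentSpace 𝓘(ℝ, E) x)) : TangentSpace 𝓘(ℝ, E') (f x) :=
  ∑ i, secondFundamentalForm f x (stdOrthonormalBasis ℝ V i : TangentSpace 𝓘(ℝ, E) x)
    (stdOrthonormalBasis ℝ V i : TangentSpace 𝓘(ℝ, E) x)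

/-- The image `f_* V` of a subspace `V` of the tangent space at `x`. -/
def pushforward (f : M → M') (x : M) (V : Submodule ℝ (TangentSpace 𝓘(ℝ, E) x)) :
    Submodule ℝ (TangentSpace 𝓘(ℝ, E') (f x)) :=
  V.map (mfderiv 𝓘(ℝ, E) 𝓘(ℝ, E') f x : TangentSpace 𝓘(ℝ, E) x →ₗ[ℝ] TangentSpace 𝓘(ℝ, E') (f x))

/-- `f` is mixed totally geodesic at `x` for the pair `(V, W)`: `h(X, Y) = 0` for `X ∈ V`,
`Y ∈ W`. -/
def MixedTotallyGeodesicAt (f : M → M') (x : M) (V W : Submodule ℝ (TangentSpace 𝓘(ℝ, E) x)) :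
    Prop :=
  ∀ X ∈ V, ∀ Y ∈ W, secondFundamentalForm f x X Y = (0 : TangentSpace 𝓘(ℝ, E') (f x))

end Immersion

end SubRiem

end

/-! Complete `N` to an orthonormal basis `N, e₁, …, e_{d-1}` of `D` at `x`, with the `eᵢ` in `D₂`.
The Gauss equation, traced over this basis, reads `Ric_{N,N} = Ric'_{N,N} + ⟪H₁, H₂⟫ - ∑ ‖h(N,
eᵢ)‖²`. Since `H_D = H₁ + H₂`, polarization gives `⟪H₁, H₂⟫ = ¼‖H_D‖² - ¼‖H₁ - H₂‖²`, and
adaptedness puts the pushed-forward basis in `D'`, so that `Ric'_{N,N}` is at most the supremum. The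
gap in the inequality is therefore a sum of three nonnegative defects, and equality means that each
of them vanishes, which is the list of three conditions.

The substance is the Gauss equation for curvature defined by Christoffel symbols in charts. With the
Levi-Civita connection along a map, the commutator of covariant derivatives is the ambient curvature
(`covAlong_comm`), and the second fundamental form is normal (`localSff_normal`). Differentiating
`⟪∇'_Y F_*Z, F_*W⟫ = ⟪∇_Y Z, W⟫` and antisymmetrizing then gives `IsIsometricNear.gauss`.
Bilinearity makes the traces independent of the basis (`sum_stdOrthonormalBasis_eq`), and
compactness makes the supremum a genuine upper bound (`bddAbove_qRicci`). -/

namespace SubRiem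

open Filter Topology

/-! ### Levi-Civita connection and curvature in coordinates, also along a map -/

section LocalCalculus

set_option maxSynthPendingDepth 3
set_option synthInstance.maxHeartbeats 200000

variable {E : Type*} [NormedAddCommGroup E] [NormedSpace ℝ E]
  {E' : Type*} [NormedAddCommGroup E'] [NormedSpace ℝ E']

/-- `G` is a Riemannian metric of class `C²` on a neighbourhood of `u`. -/
structure IsMetricNear (G : E → E →L[ℝ] E →L[ℝ] ℝ) (u : E) : Prop where
  contDiffAt : ContDiffAt ℝ 2 G u
  symm : ∀ᶠ u' in 𝓝 u, ∀ v w, G u' v w = G u' w v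
  pos : ∀ᶠ u' in 𝓝 u, ∀ v, v ≠ 0 → 0 < G u' v v

namespace IsMetricNear

variable {G : E → E →L[ℝ] E →L[ℝ] ℝ} {u : E}

theorem eventually (h : IsMetricNear G u) : ∀ᶠ u' in 𝓝 u, IsMetricNear G u' := by
  filter_upwards [h.contDiffAt.eventually (by simp), h.symm.eventually_nhds,
    h.pos.eventually_nhds] with u' h₁ h₂ h₃ using ⟨h₁, h₂, h₃⟩

/-- Positivity makes `G u` injective into the dual space, which has the same finite dimension.
Without invertibility `inverse` would be the default value `0` and `christoffel` would carry no
information. -/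
theorem isInvertible [FiniteDimensional ℝ E] (h : IsMetricNear G u) : (G u).IsInvertible := by
  have hinj : Function.Injective (G u) := by
    refine (injective_iff_map_eq_zero (G u)).2 fun v hv => ?_
    by_contra hne
    have := h.pos.self_of_nhds v hne
    simp [hv] at this
  have hfin : finrank ℝ E = finrank ℝ (E →L[ℝ] ℝ) := by
    rw [← (LinearMap.toContinuousLinearMap (𝕜 := ℝ) (E := E) (F' := ℝ)).finrank_eq]
    exact (Subspace.dual_finrank_eq (K := ℝ) (V := E)).symm
  exact ⟨(LinearEquiv.ofInjectiveOfFinrankEq (G u : E →ₗ[ℝ] E →L[ℝ] ℝ) hinj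
    hfin).toContinuousLinearEquiv, by ext; rfl⟩

theorem differentiableAt (h : IsMetricNear G u) : DifferentiableAt ℝ G u :=
  h.contDiffAt.differentiableAt (by simp)

/-- Derivatives of a symmetric metric are symmetric. -/
theorem fderiv_symm (h : IsMetricNear G u) (z v w : E) :
    fderiv ℝ G u z v w = fderiv ℝ G u z w v := by
  have key : ∀ a b : E, HasFDerivAt (fun u' => G u' a b)
      (((ContinuousLinearMap.apply ℝ ℝ b).comp (ContinuousLinearMap.apply ℝ _ a)).comp
        (fderiv ℝ G u)) u := fun a b =>
    ((ContinuousLinearMap.apply ℝ ℝ b).comp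
      (ContinuousLinearMap.apply ℝ (E →L[ℝ] ℝ) a)).hasFDerivAt.comp u
        h.differentiableAt.hasFDerivAt
  have h₁ := key v w
  have h₂ := (key w v).congr_of_eventuallyEq
    (h.symm.mono fun u' hu' => hu' v w : (fun u' => G u' v w) =ᶠ[𝓝 u] fun u' => G u' w v)
  simpa using congrArg (fun L => L z) (h₁.unique h₂)

end IsMetricNear

/-- The Christoffel symbol of the first kind as a bilinear map. -/
noncomputable def christoffelFirstL (G : E → E →L[ℝ] E →L[ℝ] ℝ) (u : E) :
    E →L[ℝ] E →L[ℝ] E →L[ℝ] ℝ :=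
  (2⁻¹ : ℝ) • (fderiv ℝ G u + (fderiv ℝ G u).flip -
    (ContinuousLinearMap.flipₗᵢ ℝ E E ℝ).toContinuousLinearEquiv.toContinuousLinearMap.comp (fderiv ℝ G u).flip)

theorem christoffelFirstL_apply (G : E → E →L[ℝ] E →L[ℝ] ℝ) (u v w : E) :
    christoffelFirstL G u v w = christoffelFirst G u v w := by
  ext z
  simp [christoffelFirstL, christoffelFirst]

/-- The Christoffel symbol as a bilinear map. -/
noncomputable def christoffelL (G : E → E →L[ℝ] E →L[ℝ] ℝ) (u : E) : E →L[ℝ] E →L[ℝ] E :=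
  (ContinuousLinearMap.compL ℝ E (E →L[ℝ] ℝ) E (G u).inverse).comp (christoffelFirstL G u)

theorem christoffelL_apply (G : E → E →L[ℝ] E →L[ℝ] ℝ) (u v w : E) :
    christoffelL G u v w = christoffel G u v w := by
  simp [christoffelL, christoffel, christoffelFirstL_apply]

variable {G : E → E →L[ℝ] E →L[ℝ] ℝ} {u : E}

theorem IsMetricNear.contDiffAt_christoffelL [FiniteDimensional ℝ E] (h : IsMetricNear G u) :
    ContDiffAt ℝ 1 (christoffelL G) u := by
  have := FiniteDimensional.complete ℝ E
  have hD : ContDiffAt ℝ 1 (fderiv ℝ G) u := h.contDiffAt.fderiv_right (by norm_num)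
  have hinv : ContDiffAt ℝ 1 (fun u' => (G u').inverse) u :=
    h.isInvertible.contDiffAt_map_inverse.comp u (h.contDiffAt.of_le (by norm_num))
  have hflip : ContDiffAt ℝ 1 (fun u' => (fderiv ℝ G u').flip) u :=
    (ContinuousLinearMap.flipₗᵢ ℝ E E (E →L[ℝ] ℝ)).contDiff.contDiffAt.comp u hD
  have hF : ContDiffAt ℝ 1 (christoffelFirstL G) u :=
    ((hD.add hflip).sub (contDiffAt_const.clm_comp hflip)).const_smul _
  exact ((ContinuousLinearMap.compL ℝ E (E →L[ℝ] ℝ) E).contDiff.contDiffAt.comp u hinv).clm_comp hF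

theorem IsMetricNear.apply_christoffelL [FiniteDimensional ℝ E] (h : IsMetricNear G u)
    (v w z : E) :
    G u (christoffelL G u v w) z =
      2⁻¹ * (fderiv ℝ G u v w z + fderiv ℝ G u w v z - fderiv ℝ G u z v w) := by
  rw [christoffelL_apply, christoffel, h.isInvertible.self_apply_inverse]
  simp [christoffelFirst]

theorem IsMetricNear.ext [FiniteDimensional ℝ E] (h : IsMetricNear G u) {v w : E}
    (hvw : ∀ z, G u v z = G u w z) : v = w := by
  refine h.isInvertible.injective ?_
  ext z
  exact hvw z

/-- The Levi-Civita connection is torsion-free. -/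
theorem IsMetricNear.christoffelL_symm [FiniteDimensional ℝ E] (h : IsMetricNear G u) (v w : E) :
    christoffelL G u v w = christoffelL G u w v := by
  refine h.ext fun z => ?_
  rw [h.apply_christoffelL, h.apply_christoffelL, h.fderiv_symm z v w]
  ring

/-- The Levi-Civita connection is metric. -/
theorem IsMetricNear.fderiv_eq [FiniteDimensional ℝ E] (h : IsMetricNear G u) (z v w : E) :
    fderiv ℝ G u z v w = G u (christoffelL G u z v) w + G u v (christoffelL G u z w) := by
  rw [h.symm.self_of_nhds v, h.apply_christoffelL, h.apply_christoffelL, h.fderiv_symm v z w,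
    h.fderiv_symm w z v, h.fderiv_symm z w v]
  ring

/-- The covariant derivative, in the direction `X`, of a vector field `V` along a map `F`. -/
noncomputable def covAlong (G : E' → E' →L[ℝ] E' →L[ℝ] ℝ) (F V : E → E') (X : E) (u : E) : E' :=
  fderiv ℝ V u X + christoffelL G (F u) (fderiv ℝ F u X) (V u)

section Along

variable {G' : E' → E' →L[ℝ] E' →L[ℝ] ℝ} {F V W : E → E'}

/-- The Levi-Civita connection along a map is metric. -/
theorem IsMetricNear.fderiv_along [FiniteDimensional ℝ E'] (h : IsMetricNear G' (F u))
    (hF : DifferentiableAt ℝ F u) (hV : DifferentiableAt ℝ V u) (hW : DifferentiableAt ℝ W u)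
    (X : E) :
    fderiv ℝ (fun u' => G' (F u') (V u') (W u')) u X =
      G' (F u) (covAlong G' F V X u) (W u) + G' (F u) (V u) (covAlong G' F W X u) := by
  have hG : HasFDerivAt (fun u' => G' (F u')) ((fderiv ℝ G' (F u)).comp (fderiv ℝ F u)) u :=
    h.differentiableAt.hasFDerivAt.comp u hF.hasFDerivAt
  have := (hG.clm_apply hV.hasFDerivAt).clm_apply hW.hasFDerivAt
  rw [this.fderiv]
  simp [covAlong, h.fderiv_eq]
  ring

theorem differentiableAt_covAlong [FiniteDimensional ℝ E'] (h : IsMetricNear G' (F u))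
    (hF : ContDiffAt ℝ 2 F u) (hV : ContDiffAt ℝ 2 V u) (X : E) :
    DifferentiableAt ℝ (covAlong G' F V X) u := by
  have hΓ := h.contDiffAt_christoffelL.comp u (hF.of_le (by norm_num))
  have hDF : ContDiffAt ℝ 1 (fun u' => fderiv ℝ F u' X) u :=
    (hF.fderiv_right (by norm_num)).clm_apply contDiffAt_const
  have hDV : ContDiffAt ℝ 1 (fun u' => fderiv ℝ V u' X) u :=
    (hV.fderiv_right (by norm_num)).clm_apply contDiffAt_const
  exact (hDV.add ((hΓ.clm_apply hDF).clm_apply (hV.of_le (by norm_num)))).differentiableAt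
    (by simp)

/-- The curvature of a metric in terms of the bilinear Christoffel symbol. -/
theorem IsMetricNear.curvature_eq [FiniteDimensional ℝ E] (h : IsMetricNear G u) (X Y Z : E) :
    curvature G u X Y Z =
      fderiv ℝ (christoffelL G) u X Y Z - fderiv ℝ (christoffelL G) u Y X Z
        + christoffelL G u X (christoffelL G u Y Z)
        - christoffelL G u Y (christoffelL G u X Z) := by
  have key : ∀ a b c : E, fderiv ℝ (fun u' => christoffel G u' a b) u c =
      fderiv ℝ (christoffelL G) u c a b := fun a b c => by
    have hd := (h.contDiffAt_christoffelL.differentiableAt (by simp)).hasFDerivAt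
    have := (hd.clm_apply (hasFDerivAt_const a u)).clm_apply (hasFDerivAt_const b u)
    simp only [christoffelL_apply] at this
    rw [this.fderiv]
    simp
  simp only [curvature, key, christoffelL_apply]

/-- The commutator of covariant derivatives along a map is the curvature. -/
theorem covAlong_comm [FiniteDimensional ℝ E'] (h : IsMetricNear G' (F u))
    (hF : ContDiffAt ℝ 2 F u) (hV : ContDiffAt ℝ 2 V u) (X Y : E) :
    covAlong G' F (covAlong G' F V Y) X u - covAlong G' F (covAlong G' F V X) Y u =
      curvature G' (F u) (fderiv ℝ F u X) (fderiv ℝ F u Y) (V u) := by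
  have hdF := (hF.differentiableAt (by simp)).hasFDerivAt
  have hdV := (hV.differentiableAt (by simp)).hasFDerivAt
  have hΓ := (h.contDiffAt_christoffelL.differentiableAt (by simp)).hasFDerivAt.comp u hdF
  have hddF := ((hF.fderiv_right (m := 1) (by norm_num)).differentiableAt (by simp)).hasFDerivAt
  have hddV := ((hV.fderiv_right (m := 1) (by norm_num)).differentiableAt (by simp)).hasFDerivAt
  have key : ∀ A B : E, fderiv ℝ (covAlong G' F V A) u B =
      fderiv ℝ (fderiv ℝ V) u B A
        + fderiv ℝ (christoffelL G') (F u) (fderiv ℝ F u B) (fderiv ℝ F u A) (V u)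
        + christoffelL G' (F u) (fderiv ℝ (fderiv ℝ F) u B A) (V u)
        + christoffelL G' (F u) (fderiv ℝ F u A) (fderiv ℝ V u B) := fun A B => by
    have := (hddV.clm_apply (hasFDerivAt_const A u)).add
      ((hΓ.clm_apply (hddF.clm_apply (hasFDerivAt_const A u))).clm_apply hdV)
    have h' : HasFDerivAt (covAlong G' F V A) _ u := this
    rw [h'.fderiv]
    simp
    abel
  -- Second derivatives of `V` and `F` drop out of the commutator by Schwarz, and the mixed terms
  -- `Γ(DF A, DV B)` pair up symmetrically. Only the `DΓ` and `ΓΓ` terms survive, and these form the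
  -- curvature.
  have hsV : fderiv ℝ (fderiv ℝ V) u X Y = fderiv ℝ (fderiv ℝ V) u Y X :=
    (hV.isSymmSndFDerivAt (by simp)) X Y
  have hsF : fderiv ℝ (fderiv ℝ F) u X Y = fderiv ℝ (fderiv ℝ F) u Y X :=
    (hF.isSymmSndFDerivAt (by simp)) X Y
  rw [h.curvature_eq]
  have hcov : ∀ A B : E, covAlong G' F (covAlong G' F V A) B u =
      fderiv ℝ (covAlong G' F V A) u B + christoffelL G' (F u) (fderiv ℝ F u B)
        (fderiv ℝ V u A + christoffelL G' (F u) (fderiv ℝ F u A) (V u)) := fun _ _ => rfl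
  rw [hcov, hcov, key, key, hsV, hsF]
  simp only [map_add]
  abel

end Along

end LocalCalculus

/-! ### Skewness of curvature and the Gauss equation in coordinates -/

section LocalGauss

set_option maxSynthPendingDepth 3
set_option synthInstance.maxHeartbeats 200000

variable {E : Type*} [NormedAddCommGroup E] [NormedSpace ℝ E]
  {E' : Type*} [NormedAddCommGroup E'] [NormedSpace ℝ E']
  {G : E → E →L[ℝ] E →L[ℝ] ℝ} {u : E}

theorem IsMetricNear.differentiableAt_christoffelL [FiniteDimensional ℝ E] (h : IsMetricNear G u)
    (Y Z : E) : DifferentiableAt ℝ (fun u' => christoffelL G u' Y Z) u :=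
  ((h.contDiffAt_christoffelL.clm_apply contDiffAt_const).clm_apply
    contDiffAt_const).differentiableAt (by simp)

/-- The second covariant derivative `∇_X ∇_Y Z` of a constant vector field. -/
noncomputable def covSecond (G : E → E →L[ℝ] E →L[ℝ] ℝ) (u X Y Z : E) : E :=
  fderiv ℝ (christoffelL G) u X Y Z + christoffelL G u X (christoffelL G u Y Z)

theorem IsMetricNear.curvature_eq_covSecond [FiniteDimensional ℝ E] (h : IsMetricNear G u)
    (X Y Z : E) : curvature G u X Y Z = covSecond G u X Y Z - covSecond G u Y X Z := by
  rw [h.curvature_eq, covSecond, covSecond]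
  abel

theorem IsMetricNear.apply_covSecond [FiniteDimensional ℝ E] (h : IsMetricNear G u)
    (X Y Z W : E) :
    G u (covSecond G u X Y Z) W =
      fderiv ℝ (fun u' => G u' (christoffelL G u' Y Z) W) u X -
        G u (christoffelL G u Y Z) (christoffelL G u X W) := by
  have hΓ := ((h.contDiffAt_christoffelL.differentiableAt (by simp)).hasFDerivAt.clm_apply
    (hasFDerivAt_const Y u)).clm_apply (hasFDerivAt_const Z u)
  have := (h.differentiableAt.hasFDerivAt.clm_apply hΓ).clm_apply (hasFDerivAt_const W u)
  rw [this.fderiv]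
  simp [covSecond, h.fderiv_eq]
  ring

/-- The curvature operators of a metric are skew-adjoint. -/
theorem IsMetricNear.curvature_skew [FiniteDimensional ℝ E] (h : IsMetricNear G u)
    (X Y Z W : E) : G u (curvature G u X Y Z) W = - G u (curvature G u X Y W) Z := by
  have hdiff : ∀ {u'}, IsMetricNear G u' → ∀ B C D : E,
      DifferentiableAt ℝ (fun u'' => G u'' (christoffelL G u'' B C) D) u' := fun h' B C D =>
    (h'.differentiableAt.clm_apply (h'.differentiableAt_christoffelL B C)).clm_apply
      (differentiableAt_const D)
  -- Metric compatibility turns `⟪∇_B Z, W⟫ + ⟪∇_B W, Z⟫` into a first derivative of `G(Z, W)`. Its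
  -- further derivative is a Hessian, symmetric in `A` and `B`, so the part of the curvature
  -- symmetric in `Z` and `W` vanishes.
  have key : ∀ A B : E, fderiv ℝ (fun u' => G u' (christoffelL G u' B Z) W) u A +
      fderiv ℝ (fun u' => G u' (christoffelL G u' B W) Z) u A =
        fderiv ℝ (fderiv ℝ fun u' => G u' Z W) u A B := fun A B => by
    have hsum := ((hdiff h B Z W).hasFDerivAt.add (hdiff h B W Z).hasFDerivAt)
    have hev : (fun u' => fderiv ℝ (fun u'' => G u'' Z W) u' B) =ᶠ[𝓝 u]
        fun u' => G u' (christoffelL G u' B Z) W + G u' (christoffelL G u' B W) Z := by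
      filter_upwards [h.eventually] with u' h'
      have := (h'.differentiableAt.hasFDerivAt.clm_apply (hasFDerivAt_const Z u')).clm_apply
        (hasFDerivAt_const W u')
      rw [this.fderiv]
      simp [h'.fderiv_eq, h'.symm.self_of_nhds Z]
    have h₁ := hsum.congr_of_eventuallyEq hev
    have hC : ContDiffAt ℝ 2 (fun u' => G u' Z W) u :=
      (h.contDiffAt.clm_apply contDiffAt_const).clm_apply contDiffAt_const
    have h₂ := ((hC.fderiv_right (m := 1) (by norm_num)).differentiableAt
      (by simp)).hasFDerivAt.clm_apply (hasFDerivAt_const B u)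
    simpa using congrArg (fun L => L A) (h₁.unique h₂)
  have hC : ContDiffAt ℝ 2 (fun u' => G u' Z W) u :=
    (h.contDiffAt.clm_apply contDiffAt_const).clm_apply contDiffAt_const
  have hs : fderiv ℝ (fderiv ℝ fun u' => G u' Z W) u X Y =
      fderiv ℝ (fderiv ℝ fun u' => G u' Z W) u Y X := (hC.isSymmSndFDerivAt (by simp)) X Y
  rw [← key, ← key] at hs
  simp only [h.curvature_eq_covSecond, map_sub, sub_apply, h.apply_covSecond]
  rw [h.symm.self_of_nhds (christoffelL G u Y Z), h.symm.self_of_nhds (christoffelL G u X Z)]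
  linarith

/-- The second fundamental form of a map `F` between open sets with metrics `G`, `G'`. -/
noncomputable def localSff (G : E → E →L[ℝ] E →L[ℝ] ℝ) (G' : E' → E' →L[ℝ] E' →L[ℝ] ℝ)
    (F : E → E') (u X Y : E) : E' :=
  fderiv ℝ (fderiv ℝ F) u X Y + christoffelL G' (F u) (fderiv ℝ F u X) (fderiv ℝ F u Y)
    - fderiv ℝ F u (christoffelL G u X Y)

/-- `F` is isometric near `u` for the metrics `G`, `G'`. -/
structure IsIsometricNear (G : E → E →L[ℝ] E →L[ℝ] ℝ) (G' : E' → E' →L[ℝ] E' →L[ℝ] ℝ)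
    (F : E → E') (u : E) : Prop where
  source : IsMetricNear G u
  target : IsMetricNear G' (F u)
  contDiffAt : ContDiffAt ℝ 3 F u
  isometric : ∀ᶠ u' in 𝓝 u, ∀ v w,
    G' (F u') (fderiv ℝ F u' v) (fderiv ℝ F u' w) = G u' v w

namespace IsIsometricNear

variable {G' : E' → E' →L[ℝ] E' →L[ℝ] ℝ} {F : E → E'}

theorem eventually (h : IsIsometricNear G G' F u) : ∀ᶠ u' in 𝓝 u, IsIsometricNear G G' F u' := by
  filter_upwards [h.source.eventually, h.contDiffAt.continuousAt.eventually h.target.eventually,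
    h.contDiffAt.eventually (by simp), h.isometric.eventually_nhds] with u' h₁ h₂ h₃ h₄
    using ⟨h₁, h₂, h₃, h₄⟩

/-- The third derivative of `F` is spent here: two covariant derivatives are applied to the field
`DF v`. -/
theorem contDiffAt_fderiv (h : IsIsometricNear G G' F u) (v : E) :
    ContDiffAt ℝ 2 (fun u' => fderiv ℝ F u' v) u :=
  (h.contDiffAt.fderiv_right (by norm_num)).clm_apply contDiffAt_const

theorem covAlong_fderiv (h : IsIsometricNear G G' F u) (X Y : E) :
    covAlong G' F (fun u' => fderiv ℝ F u' Y) X u =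
      localSff G G' F u X Y + fderiv ℝ F u (christoffelL G u X Y) := by
  have hD := ((h.contDiffAt.fderiv_right (m := 2) (by norm_num)).differentiableAt
    (by simp)).hasFDerivAt.clm_apply (hasFDerivAt_const Y u)
  rw [covAlong, hD.fderiv, localSff]
  simp

theorem localSff_symm [FiniteDimensional ℝ E] [FiniteDimensional ℝ E']
    (h : IsIsometricNear G G' F u) (X Y : E) :
    localSff G G' F u X Y = localSff G G' F u Y X := by
  have hs : fderiv ℝ (fderiv ℝ F) u X Y = fderiv ℝ (fderiv ℝ F) u Y X :=
    (h.contDiffAt.isSymmSndFDerivAt (by simp; norm_num)) X Y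
  rw [localSff, localSff, hs, h.target.christoffelL_symm, h.source.christoffelL_symm]

/-- The second fundamental form of an isometric map takes normal values. -/
theorem localSff_normal [FiniteDimensional ℝ E] [FiniteDimensional ℝ E']
    (h : IsIsometricNear G G' F u) (X Y W : E) :
    G' (F u) (localSff G G' F u X Y) (fderiv ℝ F u W) = 0 := by
  -- Differentiating the isometry condition shows that `⟪h(a, b), F_* c⟫` is skew in `b, c`. As it
  -- is also symmetric in `a, b`, the three cyclic instances force it to vanish.
  have key : ∀ a b c : E, G' (F u) (localSff G G' F u a b) (fderiv ℝ F u c) +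
      G' (F u) (localSff G G' F u a c) (fderiv ℝ F u b) = 0 := fun a b c => by
    have h₁ := h.target.fderiv_along (h.contDiffAt.differentiableAt (by simp))
      ((h.contDiffAt_fderiv b).differentiableAt (by simp))
      ((h.contDiffAt_fderiv c).differentiableAt (by simp)) a
    have hev : (fun u' => G' (F u') (fderiv ℝ F u' b) (fderiv ℝ F u' c)) =ᶠ[𝓝 u]
        fun u' => G u' b c := h.isometric.mono fun u' hu' => hu' b c
    have h₂ := (h.source.differentiableAt.hasFDerivAt.clm_apply (hasFDerivAt_const b u)).clm_apply
      (hasFDerivAt_const c u)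
    rw [hev.fderiv_eq, h₂.fderiv, h.covAlong_fderiv, h.covAlong_fderiv] at h₁
    have hi := h.isometric.self_of_nhds
    simp [h.source.fderiv_eq, hi] at h₁
    rw [h.target.symm.self_of_nhds (fderiv ℝ F u b)] at h₁
    linarith
  have h₁ := key X Y W
  have h₂ := key Y W X
  have h₃ := key W X Y
  rw [h.localSff_symm Y X] at h₂
  rw [h.localSff_symm W X, h.localSff_symm W Y] at h₃
  linarith

/-- Product rule for `⟪∇'_Y F_*Z, F_*W⟫`: the derivative that falls on `F_*W` has normal part `h(X,
W)`, which pairs with `h(Y, Z)`. Antisymmetrizing in `X, Y` yields the Gauss equation. -/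
theorem apply_covAlong_covAlong [FiniteDimensional ℝ E] [FiniteDimensional ℝ E']
    (h : IsIsometricNear G G' F u) (X Y Z W : E) :
    G' (F u) (covAlong G' F (covAlong G' F (fun u' => fderiv ℝ F u' Z) Y) X u) (fderiv ℝ F u W) =
      G u (covSecond G u X Y Z) W
        - G' (F u) (localSff G G' F u Y Z) (localSff G G' F u X W) := by
  have h₁ := h.target.fderiv_along (h.contDiffAt.differentiableAt (by simp))
    (differentiableAt_covAlong h.target (h.contDiffAt.of_le (by norm_num))
      (h.contDiffAt_fderiv Z) Y)
    ((h.contDiffAt_fderiv W).differentiableAt (by simp)) X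
  -- Normality of `h` removes it from the pairing on a whole neighbourhood, so the identity may be
  -- differentiated.
  have hev : (fun u' => G' (F u') (covAlong G' F (fun u'' => fderiv ℝ F u'' Z) Y u')
      (fderiv ℝ F u' W)) =ᶠ[𝓝 u] fun u' => G u' (christoffelL G u' Y Z) W := by
    filter_upwards [h.eventually] with u' h'
    rw [h'.covAlong_fderiv, map_add, add_apply, h'.localSff_normal,
      h'.isometric.self_of_nhds, zero_add]
  have hn := h.localSff_normal X W (christoffelL G u Y Z)
  rw [h.target.symm.self_of_nhds] at hn
  rw [hev.fderiv_eq, h.covAlong_fderiv, h.covAlong_fderiv] at h₁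
  simp only [map_add, add_apply, h.localSff_normal, hn, h.isometric.self_of_nhds] at h₁
  rw [h.source.apply_covSecond, h₁]
  ring

/-- The Gauss equation. -/
theorem gauss [FiniteDimensional ℝ E] [FiniteDimensional ℝ E']
    (h : IsIsometricNear G G' F u) (X Y Z W : E) :
    G u (curvature G u X Y Z) W =
      G' (F u) (curvature G' (F u) (fderiv ℝ F u X) (fderiv ℝ F u Y) (fderiv ℝ F u Z))
          (fderiv ℝ F u W)
        + G' (F u) (localSff G G' F u Y Z) (localSff G G' F u X W)
        - G' (F u) (localSff G G' F u X Z) (localSff G G' F u Y W) := by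
  rw [h.source.curvature_eq_covSecond, ← covAlong_comm h.target
    (h.contDiffAt.of_le (by norm_num)) (h.contDiffAt_fderiv Z) X Y]
  simp only [map_sub, sub_apply, h.apply_covAlong_covAlong]
  ring

end IsIsometricNear

end LocalGauss

/-! ### The Riemannian metric read in a chart -/

section ChartMetric

set_option maxSynthPendingDepth 3
set_option synthInstance.maxHeartbeats 200000

variable {E : Type*} [NormedAddCommGroup E] [NormedSpace ℝ E]
  {M : Type*} [TopologicalSpace M] [ChartedSpace E M]
  [RiemannianBundle (fun x : M => TangentSpace 𝓘(ℝ, E) x)]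

/-- The metric at `y`, as a function on the model space. -/
noncomputable def innerAt (y : M) (v w : E) : ℝ :=
  inner ℝ (E := TangentSpace 𝓘(ℝ, E) y) v w

theorem chartMetric_apply (x : M) (u v w : E) :
    chartMetric (E := E) x u v w = innerAt (E := E) ((extChartAt 𝓘(ℝ, E) x).symm u)
      (mfderiv 𝓘(ℝ, E) 𝓘(ℝ, E) (extChartAt 𝓘(ℝ, E) x).symm u v)
      (mfderiv 𝓘(ℝ, E) 𝓘(ℝ, E) (extChartAt 𝓘(ℝ, E) x).symm u w) := rfl

-- Tangent vectors at `x` are identified with `E` through this very chart, so its differential at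
-- `x` is the identity. Hence chart expressions at the base point are already the intrinsic ones.
omit [RiemannianBundle (fun x : M => TangentSpace 𝓘(ℝ, E) x)] in
theorem mfderiv_extChartAt_symm_self [IsManifold 𝓘(ℝ, E) ∞ M] (x : M) (v : E) :
    (mfderiv 𝓘(ℝ, E) 𝓘(ℝ, E) (extChartAt 𝓘(ℝ, E) x).symm (extChartAt 𝓘(ℝ, E) x x) v : E) = v := by
  have : IsManifold 𝓘(ℝ, E) 1 M := .of_le (n := ∞) (by simp)
  have h := mfderivWithin_range_extChartAt_symm (I := 𝓘(ℝ, E)) (x := x)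
  simp only [ModelWithCorners.range_eq_univ, mfderivWithin_univ] at h
  exact congrArg (fun L : E →L[ℝ] E => L v) h

theorem chartMetric_self [IsManifold 𝓘(ℝ, E) ∞ M] (x : M) (v w : TangentSpace 𝓘(ℝ, E) x) :
    chartMetric (E := E) x (extChartAt 𝓘(ℝ, E) x x) v w = inner ℝ v w := by
  have key : ∀ v w : E, chartMetric (E := E) x (extChartAt 𝓘(ℝ, E) x x) v w =
      innerAt (E := E) x v w := fun v w => by
    rw [chartMetric_apply, mfderiv_extChartAt_symm_self, mfderiv_extChartAt_symm_self,
      extChartAt_to_inv]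
  exact key v w

-- In the trivialization of the tangent bundle at `x`, a coordinate vector field is the constant
-- `v`.
omit [RiemannianBundle (fun x : M => TangentSpace 𝓘(ℝ, E) x)] in
theorem contMDiffAt_mfderiv_extChartAt_symm [IsManifold 𝓘(ℝ, E) ∞ M] (x : M) {u : E}
    (hu : u ∈ (extChartAt 𝓘(ℝ, E) x).target) (v : E) :
    ContMDiffAt 𝓘(ℝ, E) 𝓘(ℝ, E).tangent ∞ (fun u' =>
      (⟨(extChartAt 𝓘(ℝ, E) x).symm u',
        mfderiv 𝓘(ℝ, E) 𝓘(ℝ, E) (extChartAt 𝓘(ℝ, E) x).symm u' v⟩ :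
          TangentBundle 𝓘(ℝ, E) M)) u := by
  have hI : IsManifold 𝓘(ℝ, E) 1 M := .of_le (n := ∞) (by simp)
  have hmem : ∀ u' ∈ (extChartAt 𝓘(ℝ, E) x).target,
      (extChartAt 𝓘(ℝ, E) x).symm u' ∈ (chartAt E x).source := fun u' hu' => by
    simpa using (extChartAt 𝓘(ℝ, E) x).map_target hu'
  have htgt := (isOpen_extChartAt_target (I := 𝓘(ℝ, E)) x).mem_nhds hu
  refine (Trivialization.contMDiffAt_iff (n := ∞) (IB := 𝓘(ℝ, E))
    (e := trivializationAt E (TangentSpace 𝓘(ℝ, E)) x) ?_).2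
    ⟨(contMDiffOn_extChartAt_symm x).contMDiffAt htgt, ?_⟩
  · simpa [mem_chart_source] using hmem u hu
  · refine (contMDiffAt_const (c := v)).congr_of_eventuallyEq ?_
    filter_upwards [htgt] with u' hu'
    have hs := TangentBundle.symmL_trivializationAt (I := 𝓘(ℝ, E)) (hmem u' hu')
    rw [(extChartAt 𝓘(ℝ, E) x).right_inv hu', ModelWithCorners.range_eq_univ,
      mfderivWithin_univ] at hs
    rw [← hs]
    have hb : (extChartAt 𝓘(ℝ, E) x).symm u' ∈
        (trivializationAt E (TangentSpace 𝓘(ℝ, E)) x).baseSet := hmem u' hu'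
    have hsnd := congrArg Prod.snd
      ((trivializationAt E (TangentSpace 𝓘(ℝ, E)) x).apply_mk_symm hb v)
    rw [← Trivialization.symmL_apply (R := ℝ) _ hb] at hsnd
    exact hsnd

theorem contDiffAt_chartMetric [FiniteDimensional ℝ E] [IsManifold 𝓘(ℝ, E) ∞ M]
    [IsContMDiffRiemannianBundle 𝓘(ℝ, E) ∞ E (fun x : M => TangentSpace 𝓘(ℝ, E) x)]
    (x : M) {u : E} (hu : u ∈ (extChartAt 𝓘(ℝ, E) x).target) :
    ContDiffAt ℝ ∞ (chartMetric (E := E) x) u := by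
  have key : ContDiffOn ℝ ∞ (chartMetric (E := E) x) (extChartAt 𝓘(ℝ, E) x).target := by
    -- In finite dimension an operator-valued map is smooth once its values on fixed vectors are.
    refine contDiffOn_clm_apply.2 fun v => contDiffOn_clm_apply.2 fun w => fun u' hu' => ?_
    have := ContMDiffAt.inner_bundle (F := E) (E := fun x : M => TangentSpace 𝓘(ℝ, E) x)
      (IB := 𝓘(ℝ, E)) (contMDiffAt_mfderiv_extChartAt_symm x hu' v)
      (contMDiffAt_mfderiv_extChartAt_symm x hu' w)
    exact (contMDiffAt_iff_contDiffAt.1 this).contDiffWithinAt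
  exact key.contDiffAt ((isOpen_extChartAt_target x).mem_nhds hu)

/-- Positivity is available on the chart target, where the differential of the inverse chart is
invertible. -/
theorem isMetricNear_chartMetric [FiniteDimensional ℝ E] [IsManifold 𝓘(ℝ, E) ∞ M]
    [IsContMDiffRiemannianBundle 𝓘(ℝ, E) ∞ E (fun x : M => TangentSpace 𝓘(ℝ, E) x)]
    (x : M) : IsMetricNear (chartMetric (E := E) x) (extChartAt 𝓘(ℝ, E) x x) := by
  have hI : IsManifold 𝓘(ℝ, E) 1 M := .of_le (n := ∞) (by simp)
  refine ⟨(contDiffAt_chartMetric x (mem_extChartAt_target x)).of_le (by norm_cast),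
    .of_forall fun u v w => (real_inner_comm (F := TangentSpace 𝓘(ℝ, E) ((extChartAt 𝓘(ℝ, E) x).symm u)) _ _), ?_⟩
  filter_upwards [(isOpen_extChartAt_target x).mem_nhds (mem_extChartAt_target x)] with u hu v hv
  have hinv := isInvertible_mfderivWithin_extChartAt_symm (I := 𝓘(ℝ, E)) hu
  simp only [ModelWithCorners.range_eq_univ, mfderivWithin_univ] at hinv
  refine (real_inner_self_pos (F := TangentSpace 𝓘(ℝ, E) ((extChartAt 𝓘(ℝ, E) x).symm u))).2
    fun h0 => hv ?_
  exact hinv.injective (h0.trans (map_zero _).symm)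

end ChartMetric

/-! ### The Gauss equation on manifolds -/

section GaussManifold

set_option maxSynthPendingDepth 3
set_option synthInstance.maxHeartbeats 200000

variable {E : Type*} [NormedAddCommGroup E] [NormedSpace ℝ E]
  {M : Type*} [TopologicalSpace M] [ChartedSpace E M] [IsManifold 𝓘(ℝ, E) ∞ M]
  [RiemannianBundle (fun x : M => TangentSpace 𝓘(ℝ, E) x)]
  {E' : Type*} [NormedAddCommGroup E'] [NormedSpace ℝ E']
  {M' : Type*} [TopologicalSpace M'] [ChartedSpace E' M'] [IsManifold 𝓘(ℝ, E') ∞ M']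
  [RiemannianBundle (fun y : M' => TangentSpace 𝓘(ℝ, E') y)]
  {f : M → M'}

omit [IsManifold 𝓘(ℝ, E) ∞ M] [IsManifold 𝓘(ℝ, E') ∞ M']
  [RiemannianBundle (fun y : M' => TangentSpace 𝓘(ℝ, E') y)]
  [RiemannianBundle (fun x : M => TangentSpace 𝓘(ℝ, E) x)] in
theorem writtenInExtChartAt_self (f : M → M') (x : M) :
    writtenInExtChartAt 𝓘(ℝ, E) 𝓘(ℝ, E') x f (extChartAt 𝓘(ℝ, E) x x) =
      extChartAt 𝓘(ℝ, E') (f x) (f x) := by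
  simp [writtenInExtChartAt]

omit [IsManifold 𝓘(ℝ, E) ∞ M] [IsManifold 𝓘(ℝ, E') ∞ M']
  [RiemannianBundle (fun y : M' => TangentSpace 𝓘(ℝ, E') y)]
  [RiemannianBundle (fun x : M => TangentSpace 𝓘(ℝ, E) x)] in
theorem contDiffAt_writtenInExtChartAt (hf : ContMDiff 𝓘(ℝ, E) 𝓘(ℝ, E') ∞ f) (x : M) :
    ContDiffAt ℝ ∞ (writtenInExtChartAt 𝓘(ℝ, E) 𝓘(ℝ, E') x f) (extChartAt 𝓘(ℝ, E) x x) := by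
  have := (contMDiffAt_iff (n := ∞)).1 (hf x)
  simpa [writtenInExtChartAt, contDiffWithinAt_univ] using this.2

omit [IsManifold 𝓘(ℝ, E) ∞ M] [IsManifold 𝓘(ℝ, E') ∞ M']
  [RiemannianBundle (fun y : M' => TangentSpace 𝓘(ℝ, E') y)]
  [RiemannianBundle (fun x : M => TangentSpace 𝓘(ℝ, E) x)] in
theorem fderiv_writtenInExtChartAt (hf : ContMDiff 𝓘(ℝ, E) 𝓘(ℝ, E') ∞ f) (x : M) (v : E) :
    fderiv ℝ (writtenInExtChartAt 𝓘(ℝ, E) 𝓘(ℝ, E') x f) (extChartAt 𝓘(ℝ, E) x x) v =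
      mfderiv 𝓘(ℝ, E) 𝓘(ℝ, E') f x v := by
  rw [((hf x).mdifferentiableAt (by simp)).mfderiv, ModelWithCorners.range_eq_univ,
    fderivWithin_univ]
  rfl

-- The tangent space moves with the base point; `innerAt` takes vectors of the model space, so point
-- and differential can be replaced separately.
omit [IsManifold 𝓘(ℝ, E') ∞ M'] in
theorem innerAt_congr {g₁ g₂ : E → M'} {u : E} (h : g₁ =ᶠ[𝓝 u] g₂) (v w : E) :
    innerAt (E := E') (g₁ u) (mfderiv 𝓘(ℝ, E) 𝓘(ℝ, E') g₁ u v)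
        (mfderiv 𝓘(ℝ, E) 𝓘(ℝ, E') g₁ u w) =
      innerAt (E := E') (g₂ u) (mfderiv 𝓘(ℝ, E) 𝓘(ℝ, E') g₂ u v)
        (mfderiv 𝓘(ℝ, E) 𝓘(ℝ, E') g₂ u w) := by
  have hd : (mfderiv 𝓘(ℝ, E) 𝓘(ℝ, E') g₁ u : E →L[ℝ] E') = mfderiv 𝓘(ℝ, E) 𝓘(ℝ, E') g₂ u :=
    h.mfderiv_eq
  have h₁ : (mfderiv 𝓘(ℝ, E) 𝓘(ℝ, E') g₁ u v : E') = mfderiv 𝓘(ℝ, E) 𝓘(ℝ, E') g₂ u v :=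
    congrArg (fun L : E →L[ℝ] E' => L v) hd
  have h₂ : (mfderiv 𝓘(ℝ, E) 𝓘(ℝ, E') g₁ u w : E') = mfderiv 𝓘(ℝ, E) 𝓘(ℝ, E') g₂ u w :=
    congrArg (fun L : E →L[ℝ] E' => L w) hd
  rw [h₁, h₂, h.self_of_nhds]

/-- An isometric immersion is isometric for the metrics read in the preferred charts. -/
theorem IsIsometricImmersion.eventually_chartMetric
    (hf : IsIsometricImmersion (E := E) (E' := E') f) (x : M) :
    ∀ᶠ u in 𝓝 (extChartAt 𝓘(ℝ, E) x x), ∀ v w : E,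
      chartMetric (E := E') (f x) (writtenInExtChartAt 𝓘(ℝ, E) 𝓘(ℝ, E') x f u)
          (fderiv ℝ (writtenInExtChartAt 𝓘(ℝ, E) 𝓘(ℝ, E') x f) u v)
          (fderiv ℝ (writtenInExtChartAt 𝓘(ℝ, E) 𝓘(ℝ, E') x f) u w) =
        chartMetric (E := E) x u v w := by
  have htgt : ∀ᶠ u in 𝓝 (extChartAt 𝓘(ℝ, E) x x), u ∈ (extChartAt 𝓘(ℝ, E) x).target :=
    (isOpen_extChartAt_target x).mem_nhds (mem_extChartAt_target x)
  have hcont : ContinuousAt (f ∘ (extChartAt 𝓘(ℝ, E) x).symm) (extChartAt 𝓘(ℝ, E) x x) :=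
    hf.contMDiff.continuous.continuousAt.comp (continuousAt_extChartAt_symm x)
  have hsrc : ∀ᶠ u in 𝓝 (extChartAt 𝓘(ℝ, E) x x),
      (f ∘ (extChartAt 𝓘(ℝ, E) x).symm) u ∈ (extChartAt 𝓘(ℝ, E') (f x)).source := by
    refine hcont.eventually_mem ((isOpen_extChartAt_source (f x)).mem_nhds ?_)
    simp
  have hFd := ((contDiffAt_writtenInExtChartAt hf.contMDiff x).of_le
    (show (1 : WithTop ℕ∞) ≤ ∞ by simp)).eventually (by simp)
  filter_upwards [htgt, hsrc.eventually_nhds, hFd] with u hu hs hF v w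
  have hsu := hs.self_of_nhds
  -- Both sides are the map `f` on the chart of `M`. The chain rule applied to each expresses the
  -- same pulled-back metric once through `F` and once through `f`.
  have hev : ((extChartAt 𝓘(ℝ, E') (f x)).symm ∘ writtenInExtChartAt 𝓘(ℝ, E) 𝓘(ℝ, E') x f)
      =ᶠ[𝓝 u] f ∘ (extChartAt 𝓘(ℝ, E) x).symm := by
    filter_upwards [hs] with u' hu'
    exact (extChartAt 𝓘(ℝ, E') (f x)).left_inv hu'
  have hd₁ : MDifferentiableAt 𝓘(ℝ, E) 𝓘(ℝ, E) (extChartAt 𝓘(ℝ, E) x).symm u :=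
    ((contMDiffOn_extChartAt_symm (n := ∞) x).contMDiffAt
      ((isOpen_extChartAt_target x).mem_nhds hu)).mdifferentiableAt (by simp)
  have hd₂ : MDifferentiableAt 𝓘(ℝ, E) 𝓘(ℝ, E') f ((extChartAt 𝓘(ℝ, E) x).symm u) :=
    hf.contMDiff.mdifferentiableAt (by simp)
  have hd₃ : MDifferentiableAt 𝓘(ℝ, E) 𝓘(ℝ, E')
      (writtenInExtChartAt 𝓘(ℝ, E) 𝓘(ℝ, E') x f) u :=
    (hF.differentiableAt (by simp)).mdifferentiableAt
  have hd₄ : MDifferentiableAt 𝓘(ℝ, E') 𝓘(ℝ, E') (extChartAt 𝓘(ℝ, E') (f x)).symm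
      (writtenInExtChartAt 𝓘(ℝ, E) 𝓘(ℝ, E') x f u) :=
    ((contMDiffOn_extChartAt_symm (n := ∞) (f x)).contMDiffAt
      ((isOpen_extChartAt_target (f x)).mem_nhds
        ((extChartAt 𝓘(ℝ, E') (f x)).map_source hsu))).mdifferentiableAt (by simp)
  have key := innerAt_congr (E := E) (E' := E') hev v w
  rw [mfderiv_comp u hd₄ hd₃, mfderiv_comp u hd₂ hd₁, mfderiv_eq_fderiv] at key
  exact key.trans (IsIsometricImmersion.inner_mfderiv (E := E) (E' := E') hf _ _ _)

variable [FiniteDimensional ℝ E] [FiniteDimensional ℝ E']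
  [IsContMDiffRiemannianBundle 𝓘(ℝ, E) ∞ E (fun x : M => TangentSpace 𝓘(ℝ, E) x)]
  [IsContMDiffRiemannianBundle 𝓘(ℝ, E') ∞ E' (fun y : M' => TangentSpace 𝓘(ℝ, E') y)]

omit [IsManifold 𝓘(ℝ, E) ∞ M] [IsManifold 𝓘(ℝ, E') ∞ M'] [FiniteDimensional ℝ E]
  [FiniteDimensional ℝ E']
  [IsContMDiffRiemannianBundle 𝓘(ℝ, E) ∞ E (fun x : M => TangentSpace 𝓘(ℝ, E) x)]
  [IsContMDiffRiemannianBundle 𝓘(ℝ, E') ∞ E' (fun y : M' => TangentSpace 𝓘(ℝ, E') y)] in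
theorem secondFundamentalForm_eq (f : M → M') (x : M) (X Y : E) :
    secondFundamentalForm f x X Y = localSff (chartMetric (E := E) x) (chartMetric (E := E') (f x))
      (writtenInExtChartAt 𝓘(ℝ, E) 𝓘(ℝ, E') x f) (extChartAt 𝓘(ℝ, E) x x) X Y := by
  simp only [secondFundamentalForm, localSff, christoffelL_apply]
  rfl

theorem IsIsometricImmersion.isIsometricNear
    (hf : IsIsometricImmersion (E := E) (E' := E') f) (x : M) :
    IsIsometricNear (chartMetric (E := E) x) (chartMetric (E := E') (f x))
      (writtenInExtChartAt 𝓘(ℝ, E) 𝓘(ℝ, E') x f) (extChartAt 𝓘(ℝ, E) x x) where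
  source := isMetricNear_chartMetric x
  target := by
    rw [writtenInExtChartAt_self]
    exact isMetricNear_chartMetric (f x)
  contDiffAt := (contDiffAt_writtenInExtChartAt hf.contMDiff x).of_le (by norm_cast)
  isometric := hf.eventually_chartMetric x

/-- The Gauss equation of an isometric immersion. -/
theorem IsIsometricImmersion.gauss (hf : IsIsometricImmersion (E := E) (E' := E') f) (x : M)
    (X Y Z W : TangentSpace 𝓘(ℝ, E) x) :
    ⟪riemannCurvature x X Y Z, W⟫ =
      ⟪riemannCurvature (f x) (mfderiv 𝓘(ℝ, E) 𝓘(ℝ, E') f x X) (mfderiv 𝓘(ℝ, E) 𝓘(ℝ, E') f x Y)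
          (mfderiv 𝓘(ℝ, E) 𝓘(ℝ, E') f x Z), mfderiv 𝓘(ℝ, E) 𝓘(ℝ, E') f x W⟫
        + ⟪secondFundamentalForm (E' := E') f x Y Z, secondFundamentalForm (E' := E') f x X W⟫
        - ⟪secondFundamentalForm (E' := E') f x X Z, secondFundamentalForm (E' := E') f x Y W⟫ := by
  have h := (hf.isIsometricNear x).gauss X Y Z W
  have hd := fderiv_writtenInExtChartAt (E := E) (E' := E') hf.contMDiff x
  have hs := secondFundamentalForm_eq (E := E) (E' := E') f x
  rw [writtenInExtChartAt_self, hd X, hd Y, hd Z, hd W, ← hs Y Z, ← hs X W, ← hs X Z,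
    ← hs Y W] at h
  rw [← chartMetric_self, ← chartMetric_self, ← chartMetric_self, ← chartMetric_self]
  exact h

theorem IsIsometricImmersion.secondFundamentalForm_symm
    (hf : IsIsometricImmersion (E := E) (E' := E') f) (x : M) (X Y : TangentSpace 𝓘(ℝ, E) x) :
    secondFundamentalForm (E' := E') f x X Y = secondFundamentalForm (E' := E') f x Y X :=
  (secondFundamentalForm_eq (E := E) f x X Y).trans (((hf.isIsometricNear x).localSff_symm X Y).trans
    (secondFundamentalForm_eq (E := E) f x Y X).symm)

omit [FiniteDimensional ℝ E'] in
theorem riemannCurvature_skew (x : M) (X Y Z W : TangentSpace 𝓘(ℝ, E) x) :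
    ⟪riemannCurvature x X Y Z, W⟫ = -⟪riemannCurvature x X Y W, Z⟫ := by
  rw [← chartMetric_self, ← chartMetric_self]
  exact (isMetricNear_chartMetric (E := E) x).curvature_skew X Y Z W

end GaussManifold

/-! ### Basis-free traces and the quadratic inequality -/

section Algebra

/-- The trace `∑ᵢ B(eᵢ, eᵢ)` over an orthonormal basis of a subspace does not depend on the
basis. -/
theorem sum_stdOrthonormalBasis_eq {V W : Type*} [NormedAddCommGroup V] [InnerProductSpace ℝ V]
    [AddCommGroup W] [Module ℝ W] (B : V →ₗ[ℝ] V →ₗ[ℝ] W) (S : Submodule ℝ V)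
    [FiniteDimensional ℝ S] {ι : Type*} [Fintype ι] {e : ι → V} (he : Orthonormal ℝ e)
    (hspan : Submodule.span ℝ (Set.range e) = S) :
    ∑ i, B (stdOrthonormalBasis ℝ S i : V) (stdOrthonormalBasis ℝ S i : V) =
      ∑ i, B (e i) (e i) := by
  have hmem : ∀ i, e i ∈ S := fun i => hspan ▸ Submodule.subset_span ⟨i, rfl⟩
  have ho : Orthonormal ℝ (fun i => (⟨e i, hmem i⟩ : S)) := by
    rw [← S.subtypeₗᵢ.orthonormal_comp_iff]
    exact he
  have hs : ⊤ ≤ Submodule.span ℝ (Set.range fun i => (⟨e i, hmem i⟩ : S)) := by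
    rintro ⟨y, hy⟩ -
    have hmap : (Submodule.span ℝ (Set.range fun i => (⟨e i, hmem i⟩ : S))).map S.subtype = S := by
      rw [Submodule.map_span, ← Set.range_comp]
      exact hspan
    obtain ⟨z, hz, hzy⟩ := hmap.ge hy
    exact (Subtype.ext hzy : z = ⟨y, hy⟩) ▸ hz
  -- The trace is the linear functional induced by `B` on the tensor `∑ eᵢ ⊗ eᵢ`, which is the same
  -- for every orthonormal basis of `S`.
  have h := congrArg (TensorProduct.lift (B.compl₁₂ S.subtype S.subtype))
    ((InnerProductSpace.canonicalCovariantTensor_eq_sum S (stdOrthonormalBasis ℝ S)).symm.trans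
      (InnerProductSpace.canonicalCovariantTensor_eq_sum S (OrthonormalBasis.mk ho hs)))
  simpa using h

/-- The difference of the two sides is `¼‖p - q‖² + ∑ ‖h i‖² + (s - b)`, a sum of nonnegative terms.
-/
theorem le_quarter_norm_sq_add_and_eq_iff {V ι : Type*} [NormedAddCommGroup V]
    [InnerProductSpace ℝ V] [Fintype ι] {p q : V} {h : ι → V} {a b s : ℝ}
    (ha : a = b + ⟪p, q⟫ - ∑ i, ‖h i‖ ^ 2) (hb : b ≤ s) :
    a ≤ 1 / 4 * ‖p + q‖ ^ 2 + s ∧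
      (a = 1 / 4 * ‖p + q‖ ^ 2 + s ↔ (∀ i, h i = 0) ∧ p = q ∧ b = s) := by
  have hs : 0 ≤ ∑ i, ‖h i‖ ^ 2 := Finset.sum_nonneg fun i _ => sq_nonneg _
  have hd := sq_nonneg ‖p - q‖
  have h₁ := norm_add_sq_real p q
  have h₂ := norm_sub_sq_real p q
  refine ⟨by linarith, fun heq => ⟨fun i => ?_, ?_, by linarith⟩, ?_⟩
  · have h0 : ∑ i, ‖h i‖ ^ 2 = 0 := by linarith
    simpa using (Finset.sum_eq_zero_iff_of_nonneg fun i _ => sq_nonneg _).1 h0 i (Finset.mem_univ i)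
  · have h0 : ‖p - q‖ ^ 2 = 0 := by linarith
    simpa [sub_eq_zero] using h0
  · rintro ⟨h0, rfl, rfl⟩
    rw [ha, h₁, real_inner_self_eq_norm_sq]
    simp only [h0, norm_zero]
    norm_num
    ring

end Algebra

/-! ### Tensoriality, and Ricci curvature as a sum of sectional curvatures -/

section Tensors

set_option maxSynthPendingDepth 3
set_option synthInstance.maxHeartbeats 200000

variable {E : Type*} [NormedAddCommGroup E] [NormedSpace ℝ E]
  {M : Type*} [TopologicalSpace M] [ChartedSpace E M]
  [RiemannianBundle (fun x : M => TangentSpace 𝓘(ℝ, E) x)]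
  {E' : Type*} [NormedAddCommGroup E'] [NormedSpace ℝ E']
  {M' : Type*} [TopologicalSpace M'] [ChartedSpace E' M']
  [RiemannianBundle (fun y : M' => TangentSpace 𝓘(ℝ, E') y)]

theorem IsMetricNear.exists_bilin_curvature [FiniteDimensional ℝ E]
    {G : E → E →L[ℝ] E →L[ℝ] ℝ} {u : E} (h : IsMetricNear G u) (Y Z : E) :
    ∃ B : E →ₗ[ℝ] E →ₗ[ℝ] ℝ, ∀ v w, B v w = G u (curvature G u v Y Z) w := by
  have hadd : ∀ v v', curvature G u (v + v') Y Z = curvature G u v Y Z + curvature G u v' Y Z := by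
    intro v v'
    simp only [h.curvature_eq, map_add, add_apply]
    abel
  have hsmul : ∀ (c : ℝ) v, curvature G u (c • v) Y Z = c • curvature G u v Y Z := by
    intro c v
    simp only [h.curvature_eq, map_smul, smul_apply, smul_add, smul_sub]
  exact ⟨LinearMap.mk₂ ℝ (fun v w => G u (curvature G u v Y Z) w)
    (fun v v' w => by rw [hadd, map_add, add_apply])
    (fun c v w => by rw [hsmul, map_smul, smul_apply])
    (fun _ _ _ => map_add _ _ _) (fun _ _ _ => map_smul _ _ _), fun _ _ => rfl⟩

/-- The second fundamental form is bilinear. -/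
theorem exists_bilin_secondFundamentalForm (f : M → M') (x : M) :
    ∃ B : TangentSpace 𝓘(ℝ, E) x →ₗ[ℝ] TangentSpace 𝓘(ℝ, E) x →ₗ[ℝ] TangentSpace 𝓘(ℝ, E') (f x),
      ∀ X Y, B X Y = secondFundamentalForm f x X Y := by
  have key : ∃ B : E →ₗ[ℝ] E →ₗ[ℝ] E', ∀ X Y : E, B X Y = secondFundamentalForm f x X Y :=
    ⟨LinearMap.mk₂ ℝ (localSff (chartMetric (E := E) x) (chartMetric (E := E') (f x))
        (writtenInExtChartAt 𝓘(ℝ, E) 𝓘(ℝ, E') x f) (extChartAt 𝓘(ℝ, E) x x))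
      (fun _ _ _ => by simp only [localSff, map_add, add_apply]; abel)
      (fun _ _ _ => by simp [localSff, smul_sub])
      (fun _ _ _ => by simp only [localSff, map_add]; abel)
      (fun _ _ _ => by simp [localSff, smul_sub]),
      fun X Y => (secondFundamentalForm_eq (E := E) (E' := E') f x X Y).symm⟩
  exact key

variable [FiniteDimensional ℝ E] [IsManifold 𝓘(ℝ, E) ∞ M]
  [IsContMDiffRiemannianBundle 𝓘(ℝ, E) ∞ E (fun x : M => TangentSpace 𝓘(ℝ, E) x)]

/-- The form `(v, w) ↦ ⟪R_{v,Y} Z, w⟫` is bilinear. -/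
theorem exists_bilin_riemannCurvature (x : M) (Y Z : TangentSpace 𝓘(ℝ, E) x) :
    ∃ B : TangentSpace 𝓘(ℝ, E) x →ₗ[ℝ] TangentSpace 𝓘(ℝ, E) x →ₗ[ℝ] ℝ,
      ∀ v w, B v w = ⟪riemannCurvature x v Y Z, w⟫ := by
  obtain ⟨B, hB⟩ := (isMetricNear_chartMetric (E := E) x).exists_bilin_curvature Y Z
  exact ⟨B, fun v w => (hB v w).trans (chartMetric_self (E := E) x _ _)⟩

theorem continuous_sectionalCurvature (x : M) :
    Continuous fun p : TangentSpace 𝓘(ℝ, E) x × TangentSpace 𝓘(ℝ, E) x =>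
      sectionalCurvature x p.1 p.2 := by
  have key : Continuous fun p : E × E => chartMetric (E := E) x (extChartAt 𝓘(ℝ, E) x x)
      (curvature (chartMetric (E := E) x) (extChartAt 𝓘(ℝ, E) x x) p.1 p.2 p.2) p.1 := by
    simp only [(isMetricNear_chartMetric (E := E) x).curvature_eq]
    fun_prop
  exact key.congr fun p => chartMetric_self (E := E) x _ _

/-- Orthonormal vectors lie in the closed unit ball, a compact set on which the sectional curvature
expression is bounded by continuity. Boundedness matters because `sSup` of an unbounded set of reals
is `0`. -/
theorem bddAbove_qRicci (q : ℕ) (x : M) (V : Submodule ℝ (TangentSpace 𝓘(ℝ, E) x)) :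
    BddAbove {r : ℝ | ∃ e : Fin (q + 1) → TangentSpace 𝓘(ℝ, E) x,
      Orthonormal ℝ e ∧ (∀ i, e i ∈ V) ∧ r = qRicci x e} := by
  have : ProperSpace (TangentSpace 𝓘(ℝ, E) x) := FiniteDimensional.proper ℝ _
  obtain ⟨C, hC⟩ := ((isCompact_closedBall (0 : TangentSpace 𝓘(ℝ, E) x) 1).prod
    (isCompact_closedBall (0 : TangentSpace 𝓘(ℝ, E) x) 1)).bddAbove_image
      (continuous_sectionalCurvature x).continuousOn
  refine ⟨∑ _i : Fin q, C, ?_⟩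
  rintro _ ⟨e, he, -, rfl⟩
  refine Finset.sum_le_sum fun i _ => hC ⟨(e 0, e i.succ), ?_, rfl⟩
  simp [he.1]

theorem qRicci_le_supQRicci {q : ℕ} {x : M} {V : Submodule ℝ (TangentSpace 𝓘(ℝ, E) x)}
    {e : Fin (q + 1) → TangentSpace 𝓘(ℝ, E) x} (he : Orthonormal ℝ e) (hV : ∀ i, e i ∈ V) :
    qRicci x e ≤ supQRicci q x V :=
  le_csSup (bddAbove_qRicci q x V) ⟨e, he, hV, rfl⟩

omit [RiemannianBundle (fun x : M => TangentSpace 𝓘(ℝ, E) x)] [FiniteDimensional ℝ E]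
  [IsManifold 𝓘(ℝ, E) ∞ M]
  [IsContMDiffRiemannianBundle 𝓘(ℝ, E) ∞ E (fun x : M => TangentSpace 𝓘(ℝ, E) x)] in
theorem curvature_antisymm (G : E → E →L[ℝ] E →L[ℝ] ℝ) (u X Y Z : E) :
    curvature G u X Y Z = -curvature G u Y X Z := by
  simp only [curvature]
  abel

omit [FiniteDimensional ℝ E] [IsManifold 𝓘(ℝ, E) ∞ M]
  [IsContMDiffRiemannianBundle 𝓘(ℝ, E) ∞ E (fun x : M => TangentSpace 𝓘(ℝ, E) x)] in
theorem riemannCurvature_antisymm (x : M) (X Y Z : TangentSpace 𝓘(ℝ, E) x) :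
    riemannCurvature x X Y Z = -riemannCurvature x Y X Z :=
  curvature_antisymm (E := E) _ _ _ _ _

/-- Both skew symmetries together suffice, with no Bianchi identity. It reconciles `ricciAlong`,
which sums `K(eᵢ ∧ N)`, with `qRicci`, which sums `K(N ∧ eᵢ)`. -/
theorem sectionalCurvature_comm (x : M) (v w : TangentSpace 𝓘(ℝ, E) x) :
    sectionalCurvature x v w = sectionalCurvature x w v := by
  rw [sectionalCurvature, sectionalCurvature, riemannCurvature_skew, riemannCurvature_antisymm,
    inner_neg_left, neg_neg]

/-- The Ricci curvature along the span of an orthonormal family in the direction of its first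
member. -/
theorem ricciAlong_eq_qRicci {x : M} {q : ℕ} {V : Submodule ℝ (TangentSpace 𝓘(ℝ, E) x)}
    {e : Fin (q + 1) → TangentSpace 𝓘(ℝ, E) x} (he : Orthonormal ℝ e)
    (hspan : Submodule.span ℝ (Set.range e) = V) :
    ricciAlong x V (e 0) (e 0) = qRicci x e := by
  obtain ⟨B, hB⟩ := exists_bilin_riemannCurvature x (e 0) (e 0)
  -- The term of `e 0` itself vanishes, so the trace over `q + 1` vectors is a sum of `q`
  -- curvatures.
  have h0 : ⟪riemannCurvature x (e 0) (e 0) (e 0), e 0⟫ = 0 := by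
    have := riemannCurvature_skew x (e 0) (e 0) (e 0) (e 0)
    linarith
  have h := sum_stdOrthonormalBasis_eq B V he hspan
  simp only [hB] at h
  rw [ricciAlong, h, Fin.sum_univ_succ, h0, zero_add, qRicci]
  exact Finset.sum_congr rfl fun i _ => sectionalCurvature_comm x _ _

end Tensors

/-! ### Mean curvature and the traced Gauss equation in a frame -/

section AdaptedFrames

variable {E : Type*} [NormedAddCommGroup E] [NormedSpace ℝ E] [FiniteDimensional ℝ E]
  {M : Type*} [TopologicalSpace M] [ChartedSpace E M] [IsManifold 𝓘(ℝ, E) ∞ M]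
  [RiemannianBundle (fun x : M => TangentSpace 𝓘(ℝ, E) x)]
  [IsContMDiffRiemannianBundle 𝓘(ℝ, E) ∞ E (fun x : M => TangentSpace 𝓘(ℝ, E) x)]
  {E' : Type*} [NormedAddCommGroup E'] [NormedSpace ℝ E'] [FiniteDimensional ℝ E']
  {M' : Type*} [TopologicalSpace M'] [ChartedSpace E' M'] [IsManifold 𝓘(ℝ, E') ∞ M']
  [RiemannianBundle (fun y : M' => TangentSpace 𝓘(ℝ, E') y)]
  [IsContMDiffRiemannianBundle 𝓘(ℝ, E') ∞ E' (fun y : M' => TangentSpace 𝓘(ℝ, E') y)]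
  {f : M → M'}

omit [IsManifold 𝓘(ℝ, E) ∞ M] [IsManifold 𝓘(ℝ, E') ∞ M'] [FiniteDimensional ℝ E']
  [IsContMDiffRiemannianBundle 𝓘(ℝ, E) ∞ E (fun x : M => TangentSpace 𝓘(ℝ, E) x)]
  [IsContMDiffRiemannianBundle 𝓘(ℝ, E') ∞ E' (fun y : M' => TangentSpace 𝓘(ℝ, E') y)] in
theorem meanCurvature_eq_sum {x : M} {V : Submodule ℝ (TangentSpace 𝓘(ℝ, E) x)}
    {ι : Type*} [Fintype ι] {e : ι → TangentSpace 𝓘(ℝ, E) x} (he : Orthonormal ℝ e)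
    (hspan : Submodule.span ℝ (Set.range e) = V) :
    meanCurvature (E' := E') f x V = ∑ i, secondFundamentalForm (E' := E') f x (e i) (e i) := by
  obtain ⟨B, hB⟩ := exists_bilin_secondFundamentalForm (E := E) (E' := E') f x
  have h := sum_stdOrthonormalBasis_eq B V he hspan
  simp only [hB] at h
  exact h

omit [IsManifold 𝓘(ℝ, E) ∞ M] [IsManifold 𝓘(ℝ, E') ∞ M'] [FiniteDimensional ℝ E']
  [FiniteDimensional ℝ E]
  [IsContMDiffRiemannianBundle 𝓘(ℝ, E) ∞ E (fun x : M => TangentSpace 𝓘(ℝ, E) x)]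
  [IsContMDiffRiemannianBundle 𝓘(ℝ, E') ∞ E' (fun y : M' => TangentSpace 𝓘(ℝ, E') y)] in
theorem mixedTotallyGeodesicAt_span_iff {x : M} {ι : Type*} (n : TangentSpace 𝓘(ℝ, E) x)
    (e : ι → TangentSpace 𝓘(ℝ, E) x) :
    MixedTotallyGeodesicAt (E' := E') f x (Submodule.span ℝ {n}) (Submodule.span ℝ (Set.range e)) ↔
      ∀ i, secondFundamentalForm (E' := E') f x n (e i) = 0 := by
  obtain ⟨B, hB⟩ := exists_bilin_secondFundamentalForm (E := E) (E' := E') f x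
  simp only [MixedTotallyGeodesicAt, ← hB]
  refine ⟨fun h i => h n (Submodule.mem_span_singleton_self n) _
    (Submodule.subset_span ⟨i, rfl⟩), fun h X hX Y hY => ?_⟩
  obtain ⟨c, rfl⟩ := Submodule.mem_span_singleton.1 hX
  have hle : Submodule.span ℝ (Set.range e) ≤ LinearMap.ker (B n) :=
    Submodule.span_le.2 (Set.range_subset_iff.2 h)
  rw [map_smul, LinearMap.smul_apply, LinearMap.mem_ker.1 (hle hY), smul_zero]

/-- The contracted Gauss equation in the direction of the first member of an orthonormal family. -/
theorem IsIsometricImmersion.qRicci_eq (hf : IsIsometricImmersion (E := E) (E' := E') f) (x : M)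
    {q : ℕ} (e : Fin (q + 1) → TangentSpace 𝓘(ℝ, E) x) :
    qRicci x e = qRicci (f x) (fun i => mfderiv 𝓘(ℝ, E) 𝓘(ℝ, E') f x (e i)) +
      ⟪secondFundamentalForm (E' := E') f x (e 0) (e 0),
        ∑ i : Fin q, secondFundamentalForm (E' := E') f x (e i.succ) (e i.succ)⟫ -
      ∑ i : Fin q, ‖secondFundamentalForm (E' := E') f x (e 0) (e i.succ)‖ ^ 2 := by
  simp only [qRicci, inner_sum, ← Finset.sum_add_distrib, ← Finset.sum_sub_distrib]
  refine Finset.sum_congr rfl fun i _ => ?_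
  -- Gauss with `X = W = e 0` and `Y = Z = e i.succ`; symmetry of `h` makes the last product a
  -- square.
  rw [sectionalCurvature, hf.gauss, sectionalCurvature, hf.secondFundamentalForm_symm x (e i.succ)
    (e 0), real_inner_self_eq_norm_sq,
    real_inner_comm (secondFundamentalForm (E' := E') f x (e 0) (e 0))]

end AdaptedFrames

end SubRiem

/-! ### The Ricci inequality and its equality case -/

theorem mainTheorem9
    -- the Riemannian manifold `M`
    {E : Type*} [NormedAddCommGroup E] [NormedSpace ℝ E] [FiniteDimensional ℝ E]
    {M : Type*} [TopologicalSpace M] [ChartedSpace E M] [IsManifold 𝓘(ℝ, E) ∞ M]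
    [RiemannianBundle (fun x : M => TangentSpace 𝓘(ℝ, E) x)]
    [IsContMDiffRiemannianBundle 𝓘(ℝ, E) ∞ E (fun x : M => TangentSpace 𝓘(ℝ, E) x)]
    -- the ambient Riemannian manifold `M'`
    {E' : Type*} [NormedAddCommGroup E'] [NormedSpace ℝ E'] [FiniteDimensional ℝ E']
    {M' : Type*} [TopologicalSpace M'] [ChartedSpace E' M'] [IsManifold 𝓘(ℝ, E') ∞ M']
    [RiemannianBundle (fun y : M' => TangentSpace 𝓘(ℝ, E') y)]
    [IsContMDiffRiemannianBundle 𝓘(ℝ, E') ∞ E' (fun y : M' => TangentSpace 𝓘(ℝ, E') y)]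
    -- the distributions `D = D₁ ⊕ D₂` on `M` and `D'` on `M'`
    {d d' : ℕ} (hd : 2 ≤ d)
    (D : SubRiem.Distribution E M d) (D₁ : SubRiem.Distribution E M 1)
    (D₂ : SubRiem.Distribution E M (d - 1)) (D' : SubRiem.Distribution E' M' d')
    (hD : ∀ x, D.fiber x = D₁.fiber x ⊔ D₂.fiber x)
    (hD_orth : ∀ x, D₁.fiber x ⟂ D₂.fiber x)
    -- the adapted isometric immersion
    (f : M → M') (hf : SubRiem.IsIsometricImmersion (E := E) (E' := E') f)
    (hf_adapted : ∀ x, SubRiem.pushforward (E' := E') f x (D.fiber x) ≤ D'.fiber (f x))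
    -- the unit vector field spanning `D₁`
    (N : ∀ x : M, TangentSpace 𝓘(ℝ, E) x)
    (hN_smooth : ContMDiff 𝓘(ℝ, E) 𝓘(ℝ, E).tangent ∞
      (fun x => (⟨x, N x⟩ : TangentBundle 𝓘(ℝ, E) M)))
    (hN_unit : ∀ x, ‖N x‖ = 1)
    (hN_span : ∀ x, D₁.fiber x = Submodule.span ℝ {N x})
    (x : M) :
    SubRiem.ricciAlong x (D.fiber x) (N x) (N x) ≤
        1 / 4 * ‖SubRiem.meanCurvature (E' := E') f x (D.fiber x)‖ ^ 2
          + SubRiem.supQRicci (d - 1) (f x) (D'.fiber (f x)) ∧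
      (SubRiem.ricciAlong x (D.fiber x) (N x) (N x) =
          1 / 4 * ‖SubRiem.meanCurvature (E' := E') f x (D.fiber x)‖ ^ 2
            + SubRiem.supQRicci (d - 1) (f x) (D'.fiber (f x)) ↔
        SubRiem.MixedTotallyGeodesicAt (E' := E') f x (D₁.fiber x) (D₂.fiber x) ∧
        SubRiem.meanCurvature (E' := E') f x (D₁.fiber x) = SubRiem.meanCurvature (E' := E') f x (D₂.fiber x) ∧
        SubRiem.ricciAlong (f x) (SubRiem.pushforward (E' := E') f x (D.fiber x))
            (mfderiv 𝓘(ℝ, E) 𝓘(ℝ, E') f x (N x)) (mfderiv 𝓘(ℝ, E) 𝓘(ℝ, E') f x (N x)) =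
          SubRiem.supQRicci (d - 1) (f x) (D'.fiber (f x))) := by
  have hfin : finrank ℝ (D₂.fiber x) = d - 1 := D₂.finrank_fiber x
  -- Indexing by `Fin (d - 1)` lets `Fin.cons` produce a family on `Fin (d - 1 + 1)`, the shape
  -- `qRicci` expects, with no cast to `Fin d`.
  let b := (stdOrthonormalBasis ℝ (D₂.fiber x)).reindex (finCongr hfin)
  set e : Fin (d - 1) → TangentSpace 𝓘(ℝ, E) x := fun i => (b i : TangentSpace 𝓘(ℝ, E) x) with he_def
  have he : Orthonormal ℝ e := b.orthonormal.comp_linearIsometry (D₂.fiber x).subtypeₗᵢ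
  have he_span : Submodule.span ℝ (Set.range e) = D₂.fiber x := by
    have := congrArg (Submodule.map (D₂.fiber x).subtype) b.toBasis.span_eq
    rw [Submodule.map_span, ← Set.range_comp, Submodule.map_top, Submodule.range_subtype] at this
    rw [← this]
    congr 2
  have hNe : ∀ i, ⟪N x, e i⟫ = 0 := fun i =>
    hD_orth x |>.inner_eq (by rw [hN_span]; exact Submodule.mem_span_singleton_self _) (b i).2
  set a : Fin (d - 1 + 1) → TangentSpace 𝓘(ℝ, E) x := Fin.cons (N x) e with ha_def
  have ha : Orthonormal ℝ a := orthonormal_vecCons_iff.2 ⟨hN_unit x, hNe, he⟩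
  have ha_span : Submodule.span ℝ (Set.range a) = D.fiber x := by
    rw [hD, hN_span, ← he_span, ha_def, Fin.range_cons, Submodule.span_insert]
  have hN_orth : Orthonormal ℝ (fun _ : Unit => N x) :=
    ⟨fun _ => hN_unit x, fun i j hij => absurd (Subsingleton.elim i j) hij⟩
  have hH₁ : SubRiem.meanCurvature (E' := E') f x (D₁.fiber x) =
      SubRiem.secondFundamentalForm (E' := E') f x (N x) (N x) := by
    rw [SubRiem.meanCurvature_eq_sum hN_orth (by rw [hN_span, Set.range_const])]
    simp
  have hH₂ := SubRiem.meanCurvature_eq_sum (E' := E') (f := f) he he_span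
  have hH := SubRiem.meanCurvature_eq_sum (E' := E') (f := f) ha ha_span
  -- Separating the vector `N` from the `e i` gives `H_D = H₁ + H₂`.
  rw [Fin.sum_univ_succ] at hH
  simp only [ha_def, Fin.cons_zero, Fin.cons_succ] at hH
  rw [← hH₁, ← hH₂] at hH
  have hRic := SubRiem.ricciAlong_eq_qRicci ha ha_span
  have hda : Orthonormal ℝ (fun i => mfderiv 𝓘(ℝ, E) 𝓘(ℝ, E') f x (a i)) := by
    rw [orthonormal_iff_ite] at ha ⊢
    intro i j
    rw [hf.inner_mfderiv]
    exact ha i j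
  have hda_span : Submodule.span ℝ (Set.range fun i => mfderiv 𝓘(ℝ, E) 𝓘(ℝ, E') f x (a i)) =
      SubRiem.pushforward (E' := E') f x (D.fiber x) := by
    rw [← ha_span, SubRiem.pushforward, Submodule.map_span, ← Set.range_comp]
    rfl
  have hRic' := SubRiem.ricciAlong_eq_qRicci hda hda_span
  -- The pushed-forward basis is orthonormal and lies in `D'` by adaptedness, so it competes in the
  -- supremum.
  have hsup : SubRiem.qRicci (f x) (fun i => mfderiv 𝓘(ℝ, E) 𝓘(ℝ, E') f x (a i)) ≤
      SubRiem.supQRicci (d - 1) (f x) (D'.fiber (f x)) :=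
    SubRiem.qRicci_le_supQRicci hda fun i => hf_adapted x
      (hda_span ▸ Submodule.subset_span ⟨i, rfl⟩)
  have hgauss := hf.qRicci_eq x a
  rw [← hRic, ← hRic'] at hgauss
  rw [← hRic'] at hsup
  simp only [ha_def, Fin.cons_zero, Fin.cons_succ] at hgauss hsup
  rw [← hH₁, ← hH₂] at hgauss
  -- The fibers become spans only to test mixed total geodesicity on the frame; they are then
  -- restored for the mean curvatures.
  rw [hH, hN_span, ← he_span, SubRiem.mixedTotallyGeodesicAt_span_iff, he_span, ← hN_span]
  exact SubRiem.le_quarter_norm_sq_add_and_eq_iff hgauss hsup
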